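/- Let $n\ge 0$. Let $\mathfrak{igl}(n)$ be the complex Lie algebra with basis $L^\mu_\nu, P_\mu$ ($0\le\mu,\nu\le n-1$) and brackets $$[L^\mu_\nu,L^\rho_\lambda]=-i\delta^\rho_\nu L^\mu_\lambda+i\delta^\mu_\lambda L^\rho_\nu,\qquad [L^\mu_\nu,P_\lambda]=i\delta^\mu_\lambda P_\nu,\qquad [P_\mu,P_\nu]=0,$$ let $U=\mathcal U_{\mathfrak{igl}(n)}$ be its enveloping algebra with the primitive coproduct $\Delta$ and counit $\epsilon$, and let $U$ act on $\mathfrak X^n=\mathbb C[x^0,\dots,x^{n-1}]$ so that elements of $\mathfrak{igl}(n)$ act by derivations, with $P_\mu\triangleright x^\nu=-i\delta^\nu_\mu$ and $L^\mu_\nu\triangleright x^\rho=-i\delta^\rho_\nu x^\mu$. All maps are extended $\mathbb C[[h]]$-linearly to the $h$-adic modules $U[[h]]$, $\mathfrak X^n[[h]]$, and the (completed) tensor product of $V[[h]]$ and $W[[h]]$ is $(V\otimes W)[[h]]$. Let $\mathcal F$ be an $\mathfrak{igl}(n)$-twist: an invertible element of $(U\otimes U)[[h]]$ with $\mathcal F=1\otimes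 1+O(h)$ and $$\mathcal F_{12}(\Delta\otimes\mathrm{id})\mathcal F=\mathcal F_{23}(\mathrm{id}\otimes\Delta)\mathcal F,\qquad (\epsilon\otimes\mathrm{id})\mathcal F=1=(\mathrm{id}\otimes\epsilon)\mathcal F .$$ Write $\mathcal F^{-1}=\bar f^\alpha\otimes\bar f_\alpha$. Let $\mathfrak X^n[[h]]^{\mathcal F}$ be $\mathfrak X^n[[h]]$ with the product $f\star g=(\bar f^\alpha\triangleright f)(\bar f_\alpha\triangleright g)$, and $(U[[h]])^{\mathcal F}$ be the algebra $U[[h]]$ with the coproduct $\Delta^{\mathcal F}(\cdot)=\mathcal F\Delta(\cdot)\mathcal F^{-1}$. The smash products $\mathfrak X^n[[h]]\rtimes U[[h]]$ and $\mathfrak X^n[[h]]^{\mathcal F}\rtimes(U[[h]])^{\mathcal F}$ are the $\mathbb C[[h]]$-module $(\mathfrak X^n\otimes U)[[h]]$ with unit $1\otimes 1$ and with the product $$(f\otimes L)\#(g\otimes M)=f\,(L_{(1)}\triangleright g)\otimes L_{(2)}M,$$ formed with the undeformed product of $\mathfrak X^n[[h]]$ and coproduct $\Delta$ in the first case, with $\star$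 and $\Delta^{\mathcal F}$ in the second. Then both are unital associative $\mathbb C[[h]]$-algebras, and there is an isomorphism of $\mathbb C[[h]]$-algebras $$\varphi:\ \mathfrak X^n[[h]]^{\mathcal F}\rtimes(U[[h]])^{\mathcal F}\ \longrightarrow\ \mathfrak X^n[[h]]\rtimes U[[h]]$$ with $\varphi(f\otimes 1)=(\bar f^\alpha\triangleright f)\otimes\bar f_\alpha$ for $f\in\mathfrak X^n[[h]]$ and $\varphi(1\otimes L)=1\otimes L$ for $L\in U[[h]]$. Moreover, $\varphi$ is congruent to the identity map of $(\mathfrak X^n\otimes U)[[h]]$ modulo $h$. -/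

import Mathlib

open scoped TensorProduct PowerSeries

noncomputable section

namespace TwistSmash

/-! ### The Lie algebra `𝔦𝔤𝔩(n)` -/

/-- The Lie algebra `𝔦𝔤𝔩(n) = 𝔤𝔩(n) ⋉ 𝔱ⁿ` over `ℂ`, in coordinates with respect to its generators:
the pair `(gl, tr)` stands for `∑ gl μ ν • L^μ_ν + ∑ tr μ • P_μ`. -/
@[ext]
structure IGL (n : ℕ) where
  gl : Matrix (Fin n) (Fin n) ℂ
  tr : Fin n → ℂ

namespace IGL

variable {n : ℕ}

/-- The underlying vector space is `Matₙ(ℂ) × ℂⁿ`. -/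
def toProd (n : ℕ) : IGL n ≃ Matrix (Fin n) (Fin n) ℂ × (Fin n → ℂ) where
  toFun x := (x.gl, x.tr)
  invFun x := ⟨x.1, x.2⟩
  left_inv _ := rfl
  right_inv _ := rfl

instance : AddCommGroup (IGL n) := (toProd n).addCommGroup

instance : Module ℂ (IGL n) := (toProd n).module ℂ

@[simp] theorem zero_gl : (0 : IGL n).gl = 0 := rfl
@[simp] theorem zero_tr : (0 : IGL n).tr = 0 := rfl
@[simp] theorem add_gl (x y : IGL n) : (x + y).gl = x.gl + y.gl := rfl
@[simp] theorem add_tr (x y : IGL n) : (x + y).tr = x.tr + y.tr := rfl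
@[simp] theorem sub_gl (x y : IGL n) : (x - y).gl = x.gl - y.gl := rfl
@[simp] theorem sub_tr (x y : IGL n) : (x - y).tr = x.tr - y.tr := rfl
@[simp] theorem neg_gl (x : IGL n) : (-x).gl = -x.gl := rfl
@[simp] theorem neg_tr (x : IGL n) : (-x).tr = -x.tr := rfl
@[simp] theorem smul_gl (c : ℂ) (x : IGL n) : (c • x).gl = c • x.gl := rfl
@[simp] theorem smul_tr (c : ℂ) (x : IGL n) : (c • x).tr = c • x.tr := rfl

/-- The bracket, `ℂ`-bilinearly extended from
`[L^μ_ν, L^ρ_λ] = -i δ^ρ_ν L^μ_λ + i δ^μ_λ L^ρ_ν`, `[L^μ_ν, P_λ] = i δ^μ_λ P_ν`, `[P_μ, P_ν] = 0`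
(see `lie_L_L`, `lie_L_P`, `lie_P_P`). -/
instance : Bracket (IGL n) (IGL n) where
  bracket x y :=
    ⟨(-Complex.I) • (x.gl * y.gl - y.gl * x.gl),
      Complex.I • (Matrix.mulVec x.gl.transpose y.tr - Matrix.mulVec y.gl.transpose x.tr)⟩

@[simp] theorem lie_gl (x y : IGL n) :
    ⁅x, y⁆.gl = (-Complex.I) • (x.gl * y.gl - y.gl * x.gl) := rfl

@[simp] theorem lie_tr (x y : IGL n) :
    ⁅x, y⁆.tr = Complex.I •
      (Matrix.mulVec x.gl.transpose y.tr - Matrix.mulVec y.gl.transpose x.tr) := rfl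

instance : LieRing (IGL n) where
  add_lie x y z := by
    ext1
    · simp only [lie_gl, add_gl, add_mul, mul_add, ← smul_add]; congr 1; abel
    · simp only [lie_tr, add_tr, add_gl, Matrix.transpose_add, Matrix.add_mulVec,
        Matrix.mulVec_add, ← smul_add]; congr 1; abel
  lie_add x y z := by
    ext1
    · simp only [lie_gl, add_gl, add_mul, mul_add, ← smul_add]; congr 1; abel
    · simp only [lie_tr, add_tr, add_gl, Matrix.transpose_add, Matrix.add_mulVec,
        Matrix.mulVec_add, ← smul_add]; congr 1; abel
  lie_self x := by ext1 <;> simp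
  leibniz_lie x y z := by
    ext1
    · simp only [lie_gl, add_gl, smul_mul_assoc, mul_smul_comm, ← smul_sub, ← smul_add]
      congr 2
      noncomm_ring
    · simp only [lie_gl, lie_tr, add_tr, Matrix.transpose_smul, Matrix.transpose_sub,
        Matrix.transpose_mul, Matrix.transpose_neg, Matrix.neg_mulVec, Matrix.smul_mulVec,
        Matrix.mulVec_smul, Matrix.sub_mulVec, Matrix.mulVec_sub, Matrix.mulVec_mulVec, smul_sub,
        neg_smul, smul_neg]
      abel

instance : LieAlgebra ℂ (IGL n) where
  lie_smul c x y := by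
    ext1
    · simp only [lie_gl, smul_gl, mul_smul_comm, smul_mul_assoc, ← smul_sub]
      rw [smul_comm]
    · simp only [lie_tr, smul_tr, smul_gl, Matrix.transpose_smul, Matrix.smul_mulVec,
        Matrix.mulVec_smul, ← smul_sub]
      rw [smul_comm]

/-- The generator `L^μ_ν` of `𝔤𝔩(n)`. -/
def L (μ ν : Fin n) : IGL n := ⟨Matrix.single μ ν 1, 0⟩

/-- The generator `P_μ` of the translations `𝔱ⁿ`. -/
def P (μ : Fin n) : IGL n := ⟨0, Pi.single μ 1⟩

theorem lie_L_L (μ ν ρ l : Fin n) :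
    ⁅L μ ν, L ρ l⁆ = (-Complex.I * if ν = ρ then 1 else 0) • L μ l
      + (Complex.I * if l = μ then 1 else 0) • L ρ ν := by
  ext1
  · by_cases h₁ : ν = ρ <;> by_cases h₂ : l = μ <;>
      simp [L, h₁, h₂, sub_eq_add_neg]
  · by_cases h₁ : ν = ρ <;> by_cases h₂ : l = μ <;> simp [L, h₁, h₂]

theorem lie_L_P (μ ν l : Fin n) :
    ⁅L μ ν, P l⁆ = (Complex.I * if l = μ then 1 else 0) • P ν := by
  ext1
  · by_cases h : l = μ <;> simp [L, P, h]
  · ext i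
    by_cases h : l = μ
    · subst h
      simp [L, P, Matrix.transpose_single, Matrix.single_apply, Pi.single_apply, eq_comm]
    · simp [L, P, Matrix.transpose_single, h, Ne.symm h]

theorem lie_P_P (μ ν : Fin n) : ⁅(P μ : IGL n), P ν⁆ = 0 := by
  ext1
  · simp [P]
  · ext i; simp [P]

end IGL

/-! ### Enveloping algebras with the primitive coproduct -/

section Enveloping

attribute [local instance 100] LieRing.ofAssociativeRing

variable (𝔤 : Type) [LieRing 𝔤] [LieAlgebra ℂ 𝔤]

/-- `u ↦ u ⊗ 1 + 1 ⊗ u` on `𝔤`. -/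
def primitive : 𝔤 →ₗ⁅ℂ⁆
    (UniversalEnvelopingAlgebra ℂ 𝔤 ⊗[ℂ] UniversalEnvelopingAlgebra ℂ 𝔤) where
  toFun u := UniversalEnvelopingAlgebra.ι ℂ u ⊗ₜ 1 + 1 ⊗ₜ UniversalEnvelopingAlgebra.ι ℂ u
  map_add' x y := by
    simp only [map_add, TensorProduct.add_tmul, TensorProduct.tmul_add]; abel
  map_smul' c x := by
    simp only [map_smul, TensorProduct.smul_tmul', TensorProduct.tmul_smul, smul_add,
      RingHom.id_apply]
  map_lie' := by
    intro x y
    simp only [LieHom.map_lie, LieRing.of_associative_ring_bracket, TensorProduct.sub_tmul,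
      TensorProduct.tmul_sub, mul_add, add_mul, Algebra.TensorProduct.tmul_mul_tmul, one_mul,
      mul_one]
    abel

/-- The coproduct of `U(𝔤)`: the algebra homomorphism with `Δ(u) = u ⊗ 1 + 1 ⊗ u` on `𝔤`. -/
def envComul : UniversalEnvelopingAlgebra ℂ 𝔤 →ₐ[ℂ]
    UniversalEnvelopingAlgebra ℂ 𝔤 ⊗[ℂ] UniversalEnvelopingAlgebra ℂ 𝔤 :=
  UniversalEnvelopingAlgebra.lift ℂ (primitive 𝔤)

/-- The counit of `U(𝔤)`: the algebra homomorphism with `ε(u) = 0` on `𝔤`. -/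
def envCounit : UniversalEnvelopingAlgebra ℂ 𝔤 →ₐ[ℂ] ℂ :=
  UniversalEnvelopingAlgebra.lift ℂ (0 : 𝔤 →ₗ⁅ℂ⁆ ℂ)

theorem envComul_ι (u : 𝔤) : envComul 𝔤 (UniversalEnvelopingAlgebra.ι ℂ u) =
    UniversalEnvelopingAlgebra.ι ℂ u ⊗ₜ 1 + 1 ⊗ₜ UniversalEnvelopingAlgebra.ι ℂ u :=
  UniversalEnvelopingAlgebra.lift_ι_apply ℂ (primitive 𝔤) u

theorem envCounit_ι (u : 𝔤) : envCounit 𝔤 (UniversalEnvelopingAlgebra.ι ℂ u) = 0 :=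
  UniversalEnvelopingAlgebra.lift_ι_apply ℂ (0 : 𝔤 →ₗ⁅ℂ⁆ ℂ) u

instance envBialgebra : Bialgebra ℂ (UniversalEnvelopingAlgebra ℂ 𝔤) :=
  Bialgebra.ofAlgHom (envComul 𝔤) (envCounit 𝔤)
    (by
      apply UniversalEnvelopingAlgebra.hom_ext
      ext u
      simp [-UniversalEnvelopingAlgebra.ι_apply, envComul_ι, TensorProduct.add_tmul,
        TensorProduct.tmul_add, Algebra.TensorProduct.one_def, add_assoc])
    (by
      have h : ((Algebra.TensorProduct.lid ℂ (UniversalEnvelopingAlgebra ℂ 𝔤)).toAlgHom.comp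
          ((Algebra.TensorProduct.map (envCounit 𝔤) (AlgHom.id ℂ _)).comp (envComul 𝔤))) =
            AlgHom.id ℂ _ := by
        apply UniversalEnvelopingAlgebra.hom_ext
        apply LieHom.ext
        intro u
        simp [-UniversalEnvelopingAlgebra.ι_apply, envComul_ι, envCounit_ι]
      refine AlgHom.ext fun a => (Algebra.TensorProduct.lid ℂ _).injective ?_
      refine (DFunLike.congr_fun h a).trans ?_
      exact ((Algebra.TensorProduct.lid ℂ _).apply_symm_apply a).symm)
    (by
      apply UniversalEnvelopingAlgebra.hom_ext
      apply LieHom.ext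
      intro u
      simp [-UniversalEnvelopingAlgebra.ι_apply, envComul_ι, envCounit_ι])

end Enveloping

/-- The bialgebra `U(𝔦𝔤𝔩(n))`. -/
abbrev UIGL (n : ℕ) : Type := UniversalEnvelopingAlgebra ℂ (IGL n)

/-- The polynomial algebra `𝔛ⁿ = ℂ[x⁰, …, xⁿ⁻¹]`. -/
abbrev Coord (n : ℕ) : Type := MvPolynomial (Fin n) ℂ

section Action

attribute [local instance 100] LieRing.ofAssociativeRing

/-- The vector field by which an element of `𝔦𝔤𝔩(n)` acts: the derivation of `𝔛ⁿ` determined by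
`P_μ ▷ x^ρ = -i δ^ρ_μ` and `L^μ_ν ▷ x^ρ = -i δ^ρ_ν x^μ`. -/
def iglDerivation {n : ℕ} (u : IGL n) : Derivation ℂ (Coord n) (Coord n) :=
  MvPolynomial.mkDerivation ℂ fun ρ =>
    (-Complex.I) • (∑ μ, u.gl μ ρ • MvPolynomial.X μ + MvPolynomial.C (u.tr ρ))

theorem iglDerivation_X {n : ℕ} (u : IGL n) (ρ : Fin n) :
    iglDerivation u (MvPolynomial.X ρ) =
      (-Complex.I) • (∑ μ, u.gl μ ρ • MvPolynomial.X μ + MvPolynomial.C (u.tr ρ)) :=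
  MvPolynomial.mkDerivation_X _ _ _

theorem iglDerivation_comp_X {n : ℕ} (x y : IGL n) (ρ : Fin n) :
    iglDerivation x (iglDerivation y (MvPolynomial.X ρ)) =
      -(∑ σ, (x.gl * y.gl) σ ρ • MvPolynomial.X σ)
        - MvPolynomial.C (Matrix.mulVec y.gl.transpose x.tr ρ) := by
  have hC : ∀ c : ℂ, iglDerivation x (MvPolynomial.C c : Coord n) = 0 := fun c =>
    (iglDerivation x).map_algebraMap c
  have hI : (MvPolynomial.C Complex.I * MvPolynomial.C Complex.I : Coord n) = -1 := by
    rw [← map_mul, Complex.I_mul_I, map_neg, map_one]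
  rw [iglDerivation_X]
  simp only [Derivation.map_smul, map_add, map_sum, hC, add_zero, iglDerivation_X]
  simp only [MvPolynomial.smul_eq_C_mul, Matrix.mul_apply, Matrix.mulVec, dotProduct,
    Matrix.transpose_apply, map_sum, map_mul, map_neg, Finset.mul_sum, Finset.sum_mul, mul_add,
    Finset.sum_add_distrib, sub_eq_add_neg, ← Finset.sum_neg_distrib]
  rw [Finset.sum_comm]
  congr 1
  · refine Finset.sum_congr rfl fun σ _ => Finset.sum_congr rfl fun μ _ => ?_
    linear_combination MvPolynomial.C (x.gl σ μ) * MvPolynomial.C (y.gl μ ρ) *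
      MvPolynomial.X σ * hI
  · refine Finset.sum_congr rfl fun μ _ => ?_
    linear_combination MvPolynomial.C (x.tr μ) * MvPolynomial.C (y.gl μ ρ) * hI

/-- The resulting Lie algebra homomorphism from `𝔦𝔤𝔩(n)` to the linear endomorphisms of `𝔛ⁿ`. -/
def iglLieAction (n : ℕ) : IGL n →ₗ⁅ℂ⁆ Module.End ℂ (Coord n) where
  toFun u := (iglDerivation u : Coord n →ₗ[ℂ] Coord n)
  map_add' x y := by
    have h : iglDerivation (x + y) = iglDerivation x + iglDerivation y := by
      apply MvPolynomial.derivation_ext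
      intro ρ
      simp only [Derivation.add_apply, iglDerivation_X, IGL.add_gl, IGL.add_tr, Matrix.add_apply,
        Pi.add_apply, add_smul, Finset.sum_add_distrib, map_add, ← smul_add]
      congr 1; abel
    rw [h]; rfl
  map_smul' c x := by
    have h : iglDerivation (c • x) = c • iglDerivation x := by
      apply MvPolynomial.derivation_ext
      intro ρ
      simp only [Derivation.smul_apply, iglDerivation_X, IGL.smul_gl, IGL.smul_tr,
        Matrix.smul_apply, Pi.smul_apply]
      rw [smul_comm c]
      congr 1
      simp only [smul_add, Finset.smul_sum, MvPolynomial.smul_eq_C_mul, smul_eq_mul,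
        map_mul, mul_assoc]
    rw [h]; rfl
  map_lie' := by
    intro x y
    have h : iglDerivation ⁅x, y⁆ = ⁅iglDerivation x, iglDerivation y⁆ := by
      apply MvPolynomial.derivation_ext
      intro ρ
      rw [Derivation.commutator_apply, iglDerivation_comp_X, iglDerivation_comp_X,
        iglDerivation_X, IGL.lie_gl, IGL.lie_tr]
      simp only [Matrix.smul_apply, Matrix.sub_apply, Pi.smul_apply, Pi.sub_apply, smul_add,
        MvPolynomial.smul_eq_C_mul, smul_eq_mul, map_mul, map_sub, map_neg,
        sub_mul, mul_sub, Finset.sum_sub_distrib, Finset.mul_sum]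
      have hI : (MvPolynomial.C Complex.I * MvPolynomial.C Complex.I : Coord n) = -1 := by
        rw [← map_mul, Complex.I_mul_I, map_neg, map_one]
      simp only [← mul_assoc, neg_mul, mul_neg, hI, neg_neg, one_mul, Finset.sum_neg_distrib]
      ring
    rw [h]; exact Derivation.commutator_coe_linear_map

/-- The action `▷` of `U(𝔦𝔤𝔩(n))` on `𝔛ⁿ`. -/
def iglAction (n : ℕ) : UIGL n →ₐ[ℂ] Module.End ℂ (Coord n) :=
  UniversalEnvelopingAlgebra.lift ℂ (iglLieAction n)

theorem iglAction_ι {n : ℕ} (u : IGL n) (f : Coord n) :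
    iglAction n (UniversalEnvelopingAlgebra.ι ℂ u) f = iglDerivation u f := by
  rw [iglAction, UniversalEnvelopingAlgebra.lift_ι_apply]; rfl

end Action

theorem iglAction_P {n : ℕ} (μ ρ : Fin n) :
    iglAction n (UniversalEnvelopingAlgebra.ι ℂ (IGL.P μ)) (MvPolynomial.X ρ) =
      MvPolynomial.C (-Complex.I * if ρ = μ then 1 else 0) := by
  rw [iglAction_ι, iglDerivation_X]
  by_cases h : ρ = μ <;> simp [IGL.P, MvPolynomial.smul_eq_C_mul, h]

theorem iglAction_L {n : ℕ} (μ ν ρ : Fin n) :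
    iglAction n (UniversalEnvelopingAlgebra.ι ℂ (IGL.L μ ν)) (MvPolynomial.X ρ) =
      (-Complex.I * if ρ = ν then 1 else 0) • MvPolynomial.X μ := by
  rw [iglAction_ι, iglDerivation_X]
  by_cases h : ρ = ν
  · simp [IGL.L, Matrix.single_apply, h]
  · simp [IGL.L, h, Ne.symm h]

/-! ### `h`-adic modules and maps

For a complex vector space `V`, `V⟦X⟧` is the `h`-adic module `V[[h]]` (the variable `X` is `h`).
The completed tensor product of `V[[h]]` and `W[[h]]` is `(V ⊗ W)[[h]]`. -/

section HAdic

variable {V W : Type*} [Ring V] [Algebra ℂ V] [Ring W] [Algebra ℂ W]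

/-- `V[[h]]` as a `ℂ[[h]]`-algebra (Cauchy product), for an algebra `V` that need not be
commutative. -/
instance hAdicAlgebra (V : Type*) [Ring V] [Algebra ℂ V] : Algebra ℂ⟦X⟧ V⟦X⟧ :=
  (PowerSeries.map (algebraMap ℂ V)).toAlgebra' fun c x => by
    ext n
    simp only [PowerSeries.coeff_mul, PowerSeries.coeff_map]
    rw [← Finset.Nat.sum_antidiagonal_swap]
    exact Finset.sum_congr rfl fun p _ => Algebra.commutes _ _

theorem coeff_hAdic_smul (c : ℂ⟦X⟧) (v : V⟦X⟧) (n : ℕ) :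
    PowerSeries.coeff n (c • v) = ∑ p ∈ Finset.HasAntidiagonal.antidiagonal n,
      PowerSeries.coeff p.1 c • PowerSeries.coeff p.2 v := by
  rw [Algebra.smul_def]
  change PowerSeries.coeff n (PowerSeries.map (algebraMap ℂ V) c * v) = _
  simp only [PowerSeries.coeff_mul, PowerSeries.coeff_map, Algebra.smul_def]

/-- The pure tensor `v ⊗ w ∈ (V ⊗ W)[[h]]` of `v ∈ V[[h]]` and `w ∈ W[[h]]`:
its coefficient of `hⁿ` is `∑_{i+j=n} vᵢ ⊗ wⱼ`. -/
def hTensor (v : V⟦X⟧) (w : W⟦X⟧) : (V ⊗[ℂ] W)⟦X⟧ :=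
  PowerSeries.mk fun n => ∑ p ∈ Finset.HasAntidiagonal.antidiagonal n,
    PowerSeries.coeff p.1 v ⊗ₜ[ℂ] PowerSeries.coeff p.2 w

variable (V W) in
/-- A `ℂ[[h]]`-linear map `V[[h]] → W[[h]]`, written as the series `∑ hᵏ Tₖ` of its
coefficients, which are `ℂ`-linear maps `Tₖ : V → W`. -/
def HMap : Type _ := ℕ → V →ₗ[ℂ] W

/-- The `ℂ[[h]]`-linear map `∑ hᵏ Tₖ`: the coefficient of `hⁿ` in `T v` is `∑_{i+j=n} Tᵢ vⱼ`. -/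
def HMap.toLinear (T : HMap V W) : V⟦X⟧ →ₗ[ℂ⟦X⟧] W⟦X⟧ where
  toFun v := PowerSeries.mk fun n => ∑ p ∈ Finset.HasAntidiagonal.antidiagonal n, T p.1 (PowerSeries.coeff p.2 v)
  map_add' v w := by
    ext n
    simp [Finset.sum_add_distrib]
  map_smul' c v := by
    ext n
    simp only [RingHom.id_apply, coeff_hAdic_smul, PowerSeries.coeff_mk, map_sum, map_smul,
      Finset.smul_sum]
    simp only [Finset.sum_sigma']
    refine Finset.sum_bij' (fun x _ => ⟨(x.2.1, x.1.1 + x.2.2), (x.1.1, x.2.2)⟩)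
      (fun x _ => ⟨(x.2.1, x.1.1 + x.2.2), (x.1.1, x.2.2)⟩) ?_ ?_ ?_ ?_ ?_ <;>
      simp only [Finset.mem_sigma, Finset.HasAntidiagonal.mem_antidiagonal, Sigma.forall, Prod.forall] <;>
      rintro a b c d ⟨h₁, h₂⟩ <;> subst h₁ <;> subst h₂ <;> simp [add_left_comm]

/-- The `ℂ[[h]]`-linear extension of a `ℂ`-linear map. -/
def HMap.const (f : V →ₗ[ℂ] W) : HMap V W := fun k => if k = 0 then f else 0

end HAdic

/-! ### Smash products -/

section Smash

variable {A H : Type*} [Ring A] [Algebra ℂ A] [Ring H] [Algebra ℂ H]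

/-- For linear maps `m : A ⊗ A → A` and `δ : H → H ⊗ H`, `δ(L) = L₍₁₎ ⊗ L₍₂₎`, and an action `▷`
of `H` on `A`, the map `(f ⊗ L) ⊗ (g ⊗ M) ↦ m(f ⊗ (L₍₁₎ ▷ g)) ⊗ L₍₂₎ M`. -/
def smashCore (act : H →ₐ[ℂ] Module.End ℂ A) (m : A ⊗[ℂ] A →ₗ[ℂ] A) (δ : H →ₗ[ℂ] H ⊗[ℂ] H) :
    (A ⊗[ℂ] H) ⊗[ℂ] (A ⊗[ℂ] H) →ₗ[ℂ] A ⊗[ℂ] H :=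
  LinearMap.rTensor H m ∘ₗ
    (TensorProduct.assoc ℂ A A H).symm.toLinearMap ∘ₗ
    LinearMap.lTensor A
      (TensorProduct.map (TensorProduct.lift act.toLinearMap) (LinearMap.mul' ℂ H)) ∘ₗ
    LinearMap.lTensor A (TensorProduct.tensorTensorTensorComm ℂ H H A H).toLinearMap ∘ₗ
    (TensorProduct.assoc ℂ A (H ⊗[ℂ] H) (A ⊗[ℂ] H)).toLinearMap ∘ₗ
    LinearMap.rTensor (A ⊗[ℂ] H) (LinearMap.lTensor A δ)

theorem smashCore_tmul (act : H →ₐ[ℂ] Module.End ℂ A) (m : A ⊗[ℂ] A →ₗ[ℂ] A)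
    (δ : H →ₗ[ℂ] H ⊗[ℂ] H) (f g : A) (L M : H) {ι : Type*} (s : Finset ι) (L₁ L₂ : ι → H)
    (h : δ L = ∑ i ∈ s, L₁ i ⊗ₜ[ℂ] L₂ i) :
    smashCore act m δ ((f ⊗ₜ L) ⊗ₜ (g ⊗ₜ M)) =
      ∑ i ∈ s, m (f ⊗ₜ act (L₁ i) g) ⊗ₜ[ℂ] (L₂ i * M) := by
  simp [smashCore, h, TensorProduct.tmul_sum, TensorProduct.sum_tmul]

/-- The `ℂ[[h]]`-linear version of `smashCore`, for `m = ∑ hⁱ mᵢ` and `δ = ∑ hʲ δⱼ`. -/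
def smashMap (act : H →ₐ[ℂ] Module.End ℂ A) (m : HMap (A ⊗[ℂ] A) A) (δ : HMap H (H ⊗[ℂ] H)) :
    HMap ((A ⊗[ℂ] H) ⊗[ℂ] (A ⊗[ℂ] H)) (A ⊗[ℂ] H) :=
  fun k => ∑ p ∈ Finset.HasAntidiagonal.antidiagonal k, smashCore act (m p.1) (δ p.2)

/-- The smash product `A[[h]] ⋊ H[[h]]`, where the multiplication of `A[[h]]` is `m`, the coproduct
of `H[[h]]` is `δ`, and the action and the multiplication of `H[[h]]` are the
`ℂ[[h]]`-linear extensions of those of `H`. The underlying `ℂ[[h]]`-module is `(A ⊗ H)[[h]]`. -/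
@[nolint unusedArguments]
def SmashProduct (_act : H →ₐ[ℂ] Module.End ℂ A) (_m : HMap (A ⊗[ℂ] A) A)
    (_δ : HMap H (H ⊗[ℂ] H)) : Type _ :=
  (A ⊗[ℂ] H)⟦X⟧

namespace SmashProduct

variable {act : H →ₐ[ℂ] Module.End ℂ A} {m : HMap (A ⊗[ℂ] A) A} {δ : HMap H (H ⊗[ℂ] H)}

instance : AddCommGroup (SmashProduct act m δ) := inferInstanceAs (AddCommGroup (A ⊗[ℂ] H)⟦X⟧)

instance : Module ℂ⟦X⟧ (SmashProduct act m δ) := inferInstanceAs (Module ℂ⟦X⟧ (A ⊗[ℂ] H)⟦X⟧)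

variable (act m δ) in
/-- The identification of the underlying module with `(A ⊗ H)[[h]]`. -/
def ofSeries : (A ⊗[ℂ] H)⟦X⟧ ≃ₗ[ℂ⟦X⟧] SmashProduct act m δ :=
  LinearEquiv.refl ℂ⟦X⟧ (A ⊗[ℂ] H)⟦X⟧

/-- The underlying element of `(A ⊗ H)[[h]]`. -/
def series (a : SmashProduct act m δ) : (A ⊗[ℂ] H)⟦X⟧ := (ofSeries act m δ).symm a

/-- `(f ⊗ L) # (g ⊗ M) = m(f ⊗ (L₍₁₎ ▷ g)) ⊗ L₍₂₎ M`, extended `ℂ[[h]]`-bilinearly and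
`h`-adically continuously. -/
instance : Mul (SmashProduct act m δ) where
  mul a b := ofSeries act m δ ((smashMap act m δ).toLinear (hTensor a.series b.series))

/-- The unit is `1 ⊗ 1`. -/
instance : One (SmashProduct act m δ) where
  one := ofSeries act m δ (hTensor 1 1)

/-- The embedding `f ↦ f ⊗ 1` of `A[[h]]`. -/
def inl (f : A⟦X⟧) : SmashProduct act m δ := ofSeries act m δ (hTensor f 1)

/-- The embedding `L ↦ 1 ⊗ L` of `H[[h]]`. -/
def inr (L : H⟦X⟧) : SmashProduct act m δ := ofSeries act m δ (hTensor 1 L)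

end SmashProduct

/-- A `ℂ[[h]]`-module with a multiplication and a distinguished element is a unital associative
`ℂ[[h]]`-algebra. -/
structure IsUnitalAssocAlgebra (S : Type*) [AddCommGroup S] [Module ℂ⟦X⟧ S] [Mul S] [One S] :
    Prop where
  add_mul : ∀ a b c : S, (a + b) * c = a * c + b * c
  mul_add : ∀ a b c : S, a * (b + c) = a * b + a * c
  smul_mul : ∀ (t : ℂ⟦X⟧) (a b : S), (t • a) * b = t • (a * b)
  mul_smul : ∀ (t : ℂ⟦X⟧) (a b : S), a * (t • b) = t • (a * b)
  mul_assoc : ∀ a b c : S, a * b * c = a * (b * c)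
  one_mul : ∀ a : S, 1 * a = a
  mul_one : ∀ a : S, a * 1 = a

end Smash

/-! ### Drinfeld twists -/

section Twist

variable (H : Type*) [Ring H] [Bialgebra ℂ H]

/-- A Drinfeld twist of `H[[h]]`: an invertible `F ∈ (H ⊗ H)[[h]]` with `F = 1 ⊗ 1 + O(h)`, the
`2`-cocycle condition `F₁₂ (Δ ⊗ id)F = F₂₃ (id ⊗ Δ)F` and the normalization
`(ε ⊗ id)F = 1 = (id ⊗ ε)F`. -/
structure DrinfeldTwist where
  F : ((H ⊗[ℂ] H)⟦X⟧)ˣ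
  coeff_zero : PowerSeries.coeff 0 (F : (H ⊗[ℂ] H)⟦X⟧) = 1
  cocycle :
    PowerSeries.map (Algebra.TensorProduct.assoc ℂ ℂ ℂ H H H : (H ⊗[ℂ] H) ⊗[ℂ] H →+* _)
        (PowerSeries.map (Algebra.TensorProduct.includeLeft :
              H ⊗[ℂ] H →ₐ[ℂ] (H ⊗[ℂ] H) ⊗[ℂ] H).toRingHom F *
          PowerSeries.map (Algebra.TensorProduct.map (Bialgebra.comulAlgHom ℂ H)
              (AlgHom.id ℂ H)).toRingHom F) =
      PowerSeries.map (Algebra.TensorProduct.includeRight :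
            H ⊗[ℂ] H →ₐ[ℂ] H ⊗[ℂ] (H ⊗[ℂ] H)).toRingHom F *
        PowerSeries.map (Algebra.TensorProduct.map (AlgHom.id ℂ H)
            (Bialgebra.comulAlgHom ℂ H)).toRingHom F
  counit_left :
    PowerSeries.map ((Algebra.TensorProduct.lid ℂ H).toAlgHom.comp
      (Algebra.TensorProduct.map (Bialgebra.counitAlgHom ℂ H) (AlgHom.id ℂ H))).toRingHom F = 1
  counit_right :
    PowerSeries.map ((Algebra.TensorProduct.rid ℂ ℂ H).toAlgHom.comp
      (Algebra.TensorProduct.map (AlgHom.id ℂ H) (Bialgebra.counitAlgHom ℂ H))).toRingHom F = 1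

variable {H}

namespace DrinfeldTwist

variable (T : DrinfeldTwist H)

/-- The inverse twist `F⁻¹ ∈ (H ⊗ H)[[h]]`. -/
def inv : (H ⊗[ℂ] H)⟦X⟧ := ((T.F⁻¹ : ((H ⊗[ℂ] H)⟦X⟧)ˣ) : (H ⊗[ℂ] H)⟦X⟧)

/-- The twisted coproduct `Δ^F(L) = F Δ(L) F⁻¹`, given by its values on `L ∈ H`. -/
def comul : HMap H (H ⊗[ℂ] H) := fun k =>
  { toFun := fun L => PowerSeries.coeff k
      ((T.F : (H ⊗[ℂ] H)⟦X⟧) * PowerSeries.C (CoalgebraStruct.comul (R := ℂ) L) * T.inv)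
    map_add' := fun L M => by simp only [map_add, mul_add, add_mul]
    map_smul' := fun c L => by
      simp only [map_smul, PowerSeries.coeff_mul, PowerSeries.coeff_C, mul_ite, mul_zero,
        mul_smul_comm, smul_mul_assoc, Finset.smul_sum, Finset.sum_mul, ite_mul, zero_mul,
        smul_ite, smul_zero, RingHom.id_apply] }

variable {A : Type*} [Ring A] [Algebra ℂ A] (act : H →ₐ[ℂ] Module.End ℂ A)

/-- The star product `f ⋆ g = m(F⁻¹ ▷ (f ⊗ g))` on `A[[h]]`. -/
def star : HMap (A ⊗[ℂ] A) A := fun k =>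
  LinearMap.mul' ℂ A ∘ₗ
    TensorProduct.homTensorHomMap (RingHom.id ℂ) A A A A
      (TensorProduct.map act.toLinearMap act.toLinearMap (PowerSeries.coeff k T.inv))

/-- The map `f ↦ f̂ = ∑ (f̄^α ▷ f) ⊗ f̄_α`, where `F⁻¹ = ∑ f̄^α ⊗ f̄_α`, from `A[[h]]` to
`(A ⊗ H)[[h]]`. -/
def hat : HMap A (A ⊗[ℂ] H) := fun k =>
  { toFun := fun f =>
      LinearMap.rTensor H (act.toLinearMap.flip f) (PowerSeries.coeff k T.inv)
    map_add' := fun f g => by simp only [map_add, LinearMap.rTensor_add, LinearMap.add_apply]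
    map_smul' := fun c f => by
      simp only [map_smul, LinearMap.rTensor_smul, LinearMap.smul_apply, RingHom.id_apply] }

end DrinfeldTwist

end Twist

/-! ### The two algebras of the result -/

/-- The smash product `𝔛ⁿ[[h]] ⋊ U(𝔦𝔤𝔩(n))[[h]]`. -/
abbrev IGLSmash (n : ℕ) : Type :=
  SmashProduct (iglAction n) (HMap.const (LinearMap.mul' ℂ (Coord n)))
    (HMap.const (CoalgebraStruct.comul (R := ℂ) (A := UIGL n)))

/-- The twisted smash product `𝔛ⁿ[[h]]^F ⋊ (U(𝔦𝔤𝔩(n))[[h]])^F`. -/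
abbrev TwistedIGLSmash {n : ℕ} (T : DrinfeldTwist (UIGL n)) : Type :=
  SmashProduct (iglAction n) (T.star (iglAction n)) T.comul

end TwistSmash

end

open TwistSmash

/-!
Let `H` be a bialgebra, `A` an `H`-module algebra, and let `H ⊗ H` act on `A ⊗ H` through `▷` on `A`
and left multiplication on `H`, so that the smash product is `(f ⊗ L) # b = f (Δ(L) ▷ b)`. With
`μ : A ⊗ (A ⊗ H) → A ⊗ H` the multiplication into the first factor, that `▷` respects products means
`X ▷ μ(t) = μ((Δ ⊗ id)X ▷ t)`, while `(X ▷ (f ⊗ L)) # b = μ((id ⊗ Δ)X Δ(L)₂₃ ▷ (f ⊗ b))`. Hence the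
inverted cocycle identity `(Δ ⊗ id)F⁻¹ F⁻¹₁₂ = (id ⊗ Δ)F⁻¹ F⁻¹₂₃` makes `a ↦ F⁻¹ ▷ a` multiplicative
from the twisted to the undeformed smash product. This map has the inverse `a ↦ F ▷ a`, so
associativity and the unit laws of the twisted product are pulled back along it. Identities between
`ℂ[[h]]`-multilinear maps need only be checked on constant series.
-/

noncomputable section

namespace TwistSmash

/-! ### Smash products over a bialgebra -/

section TensorRep

variable {R : Type*} [CommSemiring R] {H K M N : Type*} [Semiring H] [Algebra R H] [Semiring K]
  [Algebra R K] [AddCommMonoid M] [Module R M] [AddCommMonoid N] [Module R N]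

/-- The external tensor product of two representations: `H ⊗ K` acts on `M ⊗ N` factor by
factor. -/
def tensorRep (ρ : H →ₐ[R] Module.End R M) (σ : K →ₐ[R] Module.End R N) :
    H ⊗[R] K →ₐ[R] Module.End R (M ⊗[R] N) :=
  Module.endTensorEndAlgHom.comp (Algebra.TensorProduct.map ρ σ)

@[simp] theorem tensorRep_tmul (ρ : H →ₐ[R] Module.End R M) (σ : K →ₐ[R] Module.End R N)
    (a : H) (b : K) (m : M) (n : N) :
    tensorRep ρ σ (a ⊗ₜ b) (m ⊗ₜ n) = ρ a m ⊗ₜ σ b n :=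
  rfl

theorem tensorRep_apply_tmul (ρ : H →ₐ[R] Module.End R M) (σ : K →ₐ[R] Module.End R N)
    (X : H ⊗[R] K) (m : M) (n : N) :
    tensorRep ρ σ X (m ⊗ₜ n) =
      TensorProduct.map (ρ.toLinearMap.flip m) (σ.toLinearMap.flip n) X := by
  induction X with
  | zero => simp
  | add X Y hX hY => simp only [map_add, LinearMap.add_apply, hX, hY]
  | tmul a b => simp

/-- The subalgebra of those elements of `H` whose actions on `M` and `N` are intertwined by the
linear map `t`. -/
def intertwined (ρ : H →ₐ[R] Module.End R M) (σ : H →ₐ[R] Module.End R N) (t : M →ₗ[R] N) :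
    Subalgebra R H where
  carrier := {a | ∀ m, t (ρ a m) = σ a (t m)}
  mul_mem' ha hb m := by rw [map_mul, map_mul, Module.End.mul_apply, ha, hb, Module.End.mul_apply]
  add_mem' ha hb m := by
    rw [map_add, map_add, LinearMap.add_apply, map_add, ha, hb, LinearMap.add_apply]
  algebraMap_mem' r m := by simp only [AlgHom.commutes, Module.algebraMap_end_apply, map_smul]

end TensorRep

section ModuleAlgebra

variable {R : Type*} [CommSemiring R] {A H : Type*} [Semiring A] [Algebra R A] [Semiring H]
  [Bialgebra R H]

/-- The action makes `A` a module algebra over the bialgebra `H`: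
`L ▷ (f g) = (L₍₁₎ ▷ f) (L₍₂₎ ▷ g)` and `L ▷ 1 = ε(L) 1`. -/
structure IsModuleAlgebra (act : H →ₐ[R] Module.End R A) : Prop where
  act_mul : ∀ (L : H) (f g : A), act L (f * g) =
    LinearMap.mul' R A (tensorRep act act (CoalgebraStruct.comul L) (f ⊗ₜ g))
  act_one : ∀ L : H, act L 1 = CoalgebraStruct.counit (R := R) L • (1 : A)

variable (R H) in
/-- `Δ ⊗ id`, with the values reassociated to `H ⊗ (H ⊗ H)`. -/
def comulLeft : H ⊗[R] H →ₐ[R] H ⊗[R] (H ⊗[R] H) :=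
  (Algebra.TensorProduct.assoc R R R H H H).toAlgHom.comp
    (Algebra.TensorProduct.map (Bialgebra.comulAlgHom R H) (AlgHom.id R H))

variable (R H) in
/-- `id ⊗ Δ`. -/
def comulRight : H ⊗[R] H →ₐ[R] H ⊗[R] (H ⊗[R] H) :=
  Algebra.TensorProduct.map (AlgHom.id R H) (Bialgebra.comulAlgHom R H)

variable (R H) in
/-- The embedding `X ↦ X₁₂ = X ⊗ 1`, reassociated to `H ⊗ (H ⊗ H)`. -/
def leg₁₂ : H ⊗[R] H →ₐ[R] H ⊗[R] (H ⊗[R] H) :=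
  (Algebra.TensorProduct.assoc R R R H H H).toAlgHom.comp Algebra.TensorProduct.includeLeft

variable (R H) in
/-- The embedding `X ↦ X₂₃ = 1 ⊗ X`. -/
def leg₂₃ : H ⊗[R] H →ₐ[R] H ⊗[R] (H ⊗[R] H) :=
  Algebra.TensorProduct.includeRight

variable (R H) in
/-- `ε ⊗ id`. -/
def counitLeft : H ⊗[R] H →ₐ[R] H :=
  (Algebra.TensorProduct.lid R H).toAlgHom.comp
    (Algebra.TensorProduct.map (Bialgebra.counitAlgHom R H) (AlgHom.id R H))

theorem comulLeft_comul (L : H) :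
    comulLeft R H (CoalgebraStruct.comul L) = comulRight R H (CoalgebraStruct.comul L) :=
  Coalgebra.coassoc_apply L

theorem counitLeft_comul (L : H) : counitLeft R H (CoalgebraStruct.comul L) = L :=
  (congrArg (TensorProduct.lid R H) (Coalgebra.rTensor_counit_comul L)).trans (one_smul R L)

/-- The representation of `H ⊗ H` on `A ⊗ H` by `▷` on the first factor and left multiplication on
the second. -/
abbrev pairAct (act : H →ₐ[R] Module.End R A) : H ⊗[R] H →ₐ[R] Module.End R (A ⊗[R] H) :=
  tensorRep act (Algebra.lmul R H)

/-- The representation of `H ⊗ (H ⊗ H)` on `A ⊗ (A ⊗ H)` by `▷` on the first two factors and left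
multiplication on the third. -/
abbrev tripleAct (act : H →ₐ[R] Module.End R A) :
    H ⊗[R] (H ⊗[R] H) →ₐ[R] Module.End R (A ⊗[R] (A ⊗[R] H)) :=
  tensorRep act (pairAct act)

variable (R A H) in
/-- The multiplication map `f ⊗ (g ⊗ M) ↦ f g ⊗ M`. -/
def mulFst : A ⊗[R] (A ⊗[R] H) →ₗ[R] A ⊗[R] H :=
  TensorProduct.lift (Algebra.lsmul R R (A ⊗[R] H)).toLinearMap

@[simp] theorem mulFst_tmul (f : A) (b : A ⊗[R] H) : mulFst R A H (f ⊗ₜ b) = f • b := rfl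

variable (act : H →ₐ[R] Module.End R A)

theorem mulFst_tripleAct_assoc (Y : H ⊗[R] H) (Q : H) (f g : A) (M : H) :
    mulFst R A H (tripleAct act (TensorProduct.assoc R H H H (Y ⊗ₜ Q)) (f ⊗ₜ (g ⊗ₜ M))) =
      LinearMap.mul' R A (tensorRep act act Y (f ⊗ₜ g)) ⊗ₜ (Q * M) := by
  induction Y with
  | zero => simp
  | add Y Z hY hZ => simp only [map_add, TensorProduct.add_tmul, LinearMap.add_apply, hY, hZ]
  | tmul P P' => simp [TensorProduct.smul_tmul']

theorem tripleAct_leg₂₃_tmul (Y : H ⊗[R] H) (f : A) (b : A ⊗[R] H) :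
    tripleAct act (leg₂₃ R H Y) (f ⊗ₜ b) = f ⊗ₜ pairAct act Y b := by
  simp [leg₂₃]

/-- The smash product on `A ⊗ H`: `(f ⊗ L) # b = f (Δ(L) ▷ b)`. -/
def smashMul : A ⊗[R] H →ₗ[R] A ⊗[R] H →ₗ[R] A ⊗[R] H :=
  TensorProduct.lift ((LinearMap.mul R (Module.End R (A ⊗[R] H))).compl₁₂
    (Algebra.lsmul R R (A ⊗[R] H)).toLinearMap
    ((pairAct act).toLinearMap ∘ₗ CoalgebraStruct.comul))

@[simp] theorem smashMul_tmul (f : A) (L : H) (b : A ⊗[R] H) :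
    smashMul act (f ⊗ₜ L) b = f • pairAct act (CoalgebraStruct.comul L) b := rfl

theorem smashMul_smul (f : A) (a b : A ⊗[R] H) :
    smashMul act (f • a) b = f • smashMul act a b := by
  induction a with
  | zero => simp
  | add a a' ha ha' => simp only [smul_add, map_add, LinearMap.add_apply, ha, ha']
  | tmul g M => rw [TensorProduct.smul_tmul', smashMul_tmul, smashMul_tmul, smul_eq_mul, mul_smul]

theorem smashMul_pairAct_tmul (X : H ⊗[R] H) (f : A) (L : H) (b : A ⊗[R] H) :
    smashMul act (pairAct act X (f ⊗ₜ L)) b =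
      mulFst R A H (tripleAct act
        (comulRight R H X * leg₂₃ R H (CoalgebraStruct.comul L)) (f ⊗ₜ b)) := by
  induction X with
  | zero => simp
  | add X Y hX hY => simp only [map_add, add_mul, LinearMap.add_apply, hX, hY]
  | tmul P Q => simp [comulRight, leg₂₃]

theorem one_smashMul (a : A ⊗[R] H) : smashMul act 1 a = a := by
  rw [Algebra.TensorProduct.one_def, smashMul_tmul, Bialgebra.comul_one, map_one, one_smul,
    Module.End.one_apply]

namespace IsModuleAlgebra

variable {act}

theorem pairAct_mulFst (hact : IsModuleAlgebra act) (X : H ⊗[R] H) (t : A ⊗[R] (A ⊗[R] H)) :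
    pairAct act X (mulFst R A H t) = mulFst R A H (tripleAct act (comulLeft R H X) t) := by
  induction X with
  | zero => simp
  | add X Y hX hY => simp only [map_add, LinearMap.add_apply, hX, hY]
  | tmul P Q =>
    induction t with
    | zero => simp
    | add t t' ht ht' => simp only [map_add, ht, ht']
    | tmul f b =>
      induction b with
      | zero => simp
      | add b b' hb hb' => simp only [TensorProduct.tmul_add, map_add, hb, hb']
      | tmul g M =>
        rw [mulFst_tmul, TensorProduct.smul_tmul', tensorRep_tmul, smul_eq_mul, hact.act_mul]
        exact (mulFst_tripleAct_assoc act _ Q f g M).symm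

theorem pairAct_comul_smashMul (hact : IsModuleAlgebra act) (L : H) (b c : A ⊗[R] H) :
    pairAct act (CoalgebraStruct.comul L) (smashMul act b c) =
      smashMul act (pairAct act (CoalgebraStruct.comul L) b) c := by
  induction b with
  | zero => simp
  | add b b' hb hb' => simp only [map_add, LinearMap.add_apply, hb, hb']
  | tmul g M =>
    rw [smashMul_pairAct_tmul, ← comulLeft_comul, map_mul, Module.End.mul_apply,
      tripleAct_leg₂₃_tmul, ← hact.pairAct_mulFst, mulFst_tmul, smashMul_tmul]

theorem smashMul_assoc (hact : IsModuleAlgebra act) (a b c : A ⊗[R] H) :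
    smashMul act (smashMul act a b) c = smashMul act a (smashMul act b c) := by
  induction a with
  | zero => simp
  | add a a' ha ha' => simp only [map_add, LinearMap.add_apply, ha, ha']
  | tmul f L =>
    rw [smashMul_tmul, smashMul_smul, ← hact.pairAct_comul_smashMul, smashMul_tmul]

theorem pairAct_one_tmul (hact : IsModuleAlgebra act) (X : H ⊗[R] H) (L : H) :
    pairAct act X (1 ⊗ₜ L) = 1 ⊗ₜ (counitLeft R H X * L) := by
  induction X with
  | zero => simp
  | add X Y hX hY =>
    simp only [map_add, LinearMap.add_apply, add_mul, TensorProduct.tmul_add, hX, hY]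
  | tmul P Q => simp [counitLeft, hact.act_one, TensorProduct.smul_tmul]

theorem smashMul_one (hact : IsModuleAlgebra act) (a : A ⊗[R] H) : smashMul act a 1 = a := by
  induction a with
  | zero => simp
  | add a a' ha ha' => simp only [map_add, LinearMap.add_apply, ha, ha']
  | tmul f L =>
    rw [Algebra.TensorProduct.one_def, smashMul_tmul, hact.pairAct_one_tmul, counitLeft_comul,
      mul_one, TensorProduct.smul_tmul', smul_eq_mul, mul_one]

end IsModuleAlgebra

end ModuleAlgebra

/-! ### Module algebras over enveloping algebras -/

section Enveloping

attribute [local instance 100] LieRing.ofAssociativeRing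

theorem subalgebra_eq_top_of_ι_mem {R 𝔤 : Type*} [CommRing R] [LieRing 𝔤] [LieAlgebra R 𝔤]
    {S : Subalgebra R (UniversalEnvelopingAlgebra R 𝔤)}
    (hS : ∀ u : 𝔤, UniversalEnvelopingAlgebra.ι R u ∈ S) : S = ⊤ := by
  let j : 𝔤 →ₗ⁅R⁆ S :=
    { toFun := fun u => ⟨UniversalEnvelopingAlgebra.ι R u, hS u⟩
      map_add' := fun x y => Subtype.ext (map_add _ x y)
      map_smul' := fun c x => Subtype.ext (map_smul _ c x)
      map_lie' := fun {x y} => Subtype.ext (LieHom.map_lie _ x y) }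
  have lift_eq_id : S.val.comp (UniversalEnvelopingAlgebra.lift R j) = AlgHom.id R _ := by
    refine UniversalEnvelopingAlgebra.hom_ext R (LieHom.ext fun u => ?_)
    exact congrArg S.val (UniversalEnvelopingAlgebra.lift_ι_apply R j u)
  refine Algebra.eq_top_iff.2 fun L => ?_
  rw [← AlgHom.id_apply (R := R) L, ← lift_eq_id]
  exact (UniversalEnvelopingAlgebra.lift R j L).2

variable {𝔤 : Type} [LieRing 𝔤] [LieAlgebra ℂ 𝔤] {A : Type*} [Ring A] [Algebra ℂ A]

theorem IsModuleAlgebra.of_leibniz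
    {act : UniversalEnvelopingAlgebra ℂ 𝔤 →ₐ[ℂ] Module.End ℂ A}
    (leibniz : ∀ (u : 𝔤) (f g : A), act (UniversalEnvelopingAlgebra.ι ℂ u) (f * g) =
      act (UniversalEnvelopingAlgebra.ι ℂ u) f * g +
        f * act (UniversalEnvelopingAlgebra.ι ℂ u) g) :
    IsModuleAlgebra act where
  act_mul := by
    have htop : intertwined ((tensorRep act act).comp (Bialgebra.comulAlgHom ℂ _)) act
        (LinearMap.mul' ℂ A) = ⊤ := by
      refine subalgebra_eq_top_of_ι_mem fun u t => ?_
      have comul_ι : Bialgebra.comulAlgHom ℂ _ (UniversalEnvelopingAlgebra.ι ℂ u) = _ :=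
        envComul_ι 𝔤 u
      rw [AlgHom.comp_apply, comul_ι]
      induction t with
      | zero => simp only [map_zero]
      | add t t' ht ht' => rw [map_add, map_add, ht, ht', map_add, map_add]
      | tmul f g =>
        simp only [map_add, LinearMap.add_apply, tensorRep_tmul, map_one, Module.End.one_apply,
          LinearMap.mul'_apply, leibniz]
    exact fun L f g => ((Algebra.eq_top_iff.1 htop L) (f ⊗ₜ g)).symm
  act_one := by
    have ι_one (u : 𝔤) : act (UniversalEnvelopingAlgebra.ι ℂ u) 1 = 0 := by
      simpa only [mul_one, one_mul, left_eq_add] using leibniz u 1 1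
    have htop : intertwined ((Algebra.lmul ℂ ℂ).comp (Bialgebra.counitAlgHom ℂ _)) act
        (LinearMap.toSpanSingleton ℂ A 1) = ⊤ := by
      refine subalgebra_eq_top_of_ι_mem fun u c => ?_
      have counit_ι : Bialgebra.counitAlgHom ℂ _ (UniversalEnvelopingAlgebra.ι ℂ u) = _ :=
        envCounit_ι 𝔤 u
      rw [AlgHom.comp_apply, counit_ι]
      simp only [map_zero, LinearMap.zero_apply, LinearMap.toSpanSingleton_apply, map_smul, ι_one,
        smul_zero]
    intro L
    simpa using ((Algebra.eq_top_iff.1 htop L) 1).symm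

theorem iglAction_isModuleAlgebra (n : ℕ) : IsModuleAlgebra (iglAction n) :=
  .of_leibniz fun u f g => by
    simp only [iglAction_ι, Derivation.leibniz, smul_eq_mul, mul_comm, add_comm]

end Enveloping

/-! ### `h`-adic extension of representations -/

section HAdic

variable {V W Z : Type*} [Ring V] [Algebra ℂ V] [Ring W] [Algebra ℂ W] [Ring Z] [Algebra ℂ Z]

theorem hAdic_X_smul (v : V⟦X⟧) : (PowerSeries.X : ℂ⟦X⟧) • v = PowerSeries.X * v := by
  rw [Algebra.smul_def]
  exact congrArg (· * v) (PowerSeries.map_X (algebraMap ℂ V))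

theorem exists_eq_add_X_smul {v w : V⟦X⟧} (h : PowerSeries.coeff 0 v = PowerSeries.coeff 0 w) :
    ∃ c : V⟦X⟧, v = w + (PowerSeries.X : ℂ⟦X⟧) • c := by
  obtain ⟨c, hc⟩ : PowerSeries.X ∣ v - w := by
    rw [PowerSeries.X_dvd_iff, ← PowerSeries.coeff_zero_eq_constantCoeff_apply, map_sub, h,
      sub_self]
  exact ⟨c, by rw [hAdic_X_smul, ← hc, add_sub_cancel]⟩

theorem hAdic_linearMap_ext {S T : V⟦X⟧ →ₗ[ℂ⟦X⟧] W⟦X⟧}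
    (h : ∀ v : V, S (PowerSeries.C v) = T (PowerSeries.C v)) : S = T := by
  have sub_eq_X_mul (v : V⟦X⟧) : ∃ c, (S - T) v = PowerSeries.X * (S - T) c := by
    obtain ⟨c, hc⟩ := exists_eq_add_X_smul (w := PowerSeries.C (PowerSeries.coeff 0 v))
      (PowerSeries.coeff_zero_C _).symm
    have sub_C : (S - T) (PowerSeries.C (PowerSeries.coeff 0 v)) = 0 := sub_eq_zero.2 (h _)
    exact ⟨c, by rw [hc, LinearMap.map_add, sub_C, zero_add, LinearMap.map_smul, hAdic_X_smul]⟩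
  have coeff_sub_eq_zero (k : ℕ) : ∀ v, PowerSeries.coeff k ((S - T) v) = 0 := by
    induction k with
    | zero =>
      intro v
      obtain ⟨c, hc⟩ := sub_eq_X_mul v
      rw [hc, PowerSeries.coeff_zero_X_mul]
    | succ k ih =>
      intro v
      obtain ⟨c, hc⟩ := sub_eq_X_mul v
      rw [hc, PowerSeries.coeff_succ_X_mul, ih]
  exact sub_eq_zero.1 (LinearMap.ext fun v => PowerSeries.ext fun k => coeff_sub_eq_zero k v)

theorem hAdic_bilin_ext {S T : V⟦X⟧ →ₗ[ℂ⟦X⟧] W⟦X⟧ →ₗ[ℂ⟦X⟧] Z⟦X⟧}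
    (h : ∀ (v : V) (w : W), S (PowerSeries.C v) (PowerSeries.C w) =
      T (PowerSeries.C v) (PowerSeries.C w)) : S = T := by
  refine LinearMap.ext₂ fun v w => ?_
  have ext_left (w : W) : S.flip (PowerSeries.C w) = T.flip (PowerSeries.C w) :=
    hAdic_linearMap_ext fun v => h v w
  exact LinearMap.congr_fun (hAdic_linearMap_ext fun w => LinearMap.congr_fun (ext_left w) v) w

theorem hAdic_bilin_assoc {B : V⟦X⟧ →ₗ[ℂ⟦X⟧] V⟦X⟧ →ₗ[ℂ⟦X⟧] V⟦X⟧}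
    (h : ∀ u v w : V,
      B (B (PowerSeries.C u) (PowerSeries.C v)) (PowerSeries.C w) =
        B (PowerSeries.C u) (B (PowerSeries.C v) (PowerSeries.C w)))
    (a b c : V⟦X⟧) : B (B a b) c = B a (B b c) := by
  have assoc_C (u : V) : B.comp (B (PowerSeries.C u)) = B.compr₂ (B (PowerSeries.C u)) :=
    hAdic_bilin_ext (h u)
  refine LinearMap.congr_fun (f := B.flip c ∘ₗ B.flip b) (g := B.flip (B b c))
    (hAdic_linearMap_ext fun u => ?_) a
  exact LinearMap.congr_fun₂ (assoc_C u) b c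

namespace HMap

theorem coeff_toLinear (T : HMap V W) (v : V⟦X⟧) (k : ℕ) :
    PowerSeries.coeff k (T.toLinear v) =
      ∑ p ∈ Finset.HasAntidiagonal.antidiagonal k, T p.1 (PowerSeries.coeff p.2 v) :=
  PowerSeries.coeff_mk k fun k =>
    ∑ p ∈ Finset.HasAntidiagonal.antidiagonal k, T p.1 (PowerSeries.coeff p.2 v)

theorem coeff_toLinear_C (T : HMap V W) (v : V) (k : ℕ) :
    PowerSeries.coeff k (T.toLinear (PowerSeries.C v)) = T k v := by
  rw [coeff_toLinear, Finset.sum_eq_single_of_mem (k, 0) (by simp), PowerSeries.coeff_zero_C]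
  rintro ⟨i, j⟩ hp hne
  have hj : j ≠ 0 := by
    rintro rfl
    exact hne (by simpa using hp)
  rw [PowerSeries.coeff_C_of_ne_zero hj, map_zero]

theorem coeff_const_toLinear (t : V →ₗ[ℂ] W) (v : V⟦X⟧) (k : ℕ) :
    PowerSeries.coeff k ((const t).toLinear v) = t (PowerSeries.coeff k v) := by
  rw [coeff_toLinear, Finset.sum_eq_single_of_mem (0, k) (by simp)]
  · rfl
  rintro ⟨i, j⟩ hp hne
  have hi : i ≠ 0 := by
    rintro rfl
    exact hne (by simpa using hp)
  simp [const, hi]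

theorem const_toLinear_C (t : V →ₗ[ℂ] W) (v : V) :
    (const t).toLinear (PowerSeries.C v) = PowerSeries.C (t v) := by
  ext k
  rw [coeff_const_toLinear, PowerSeries.coeff_C, PowerSeries.coeff_C, apply_ite t, map_zero]

end HMap

theorem map_hAdic_smul (f : V →ₐ[ℂ] W) (c : ℂ⟦X⟧) (v : V⟦X⟧) :
    PowerSeries.map f.toRingHom (c • v) = c • PowerSeries.map f.toRingHom v := by
  ext k
  simp [coeff_hAdic_smul]

theorem hTensor_eq_mul (v : V⟦X⟧) (w : W⟦X⟧) :
    hTensor v w =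
      PowerSeries.map (Algebra.TensorProduct.includeLeft : V →ₐ[ℂ] V ⊗[ℂ] W).toRingHom v *
        PowerSeries.map (Algebra.TensorProduct.includeRight : W →ₐ[ℂ] V ⊗[ℂ] W).toRingHom w := by
  ext k
  simp [hTensor, PowerSeries.coeff_mul]

/-- The pure tensor `hTensor` as a `ℂ[[h]]`-bilinear map. -/
def hTensorBilin (V W : Type*) [Ring V] [Algebra ℂ V] [Ring W] [Algebra ℂ W] :
    V⟦X⟧ →ₗ[ℂ⟦X⟧] W⟦X⟧ →ₗ[ℂ⟦X⟧] (V ⊗[ℂ] W)⟦X⟧ :=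
  LinearMap.mk₂ ℂ⟦X⟧ hTensor
    (fun v v' w => by simp only [hTensor_eq_mul, map_add, add_mul])
    (fun c v w => by rw [hTensor_eq_mul, hTensor_eq_mul, map_hAdic_smul, smul_mul_assoc])
    (fun v w w' => by simp only [hTensor_eq_mul, map_add, mul_add])
    (fun c v w => by rw [hTensor_eq_mul, hTensor_eq_mul, map_hAdic_smul, mul_smul_comm])

theorem hTensorBilin_apply (v : V⟦X⟧) (w : W⟦X⟧) : hTensorBilin V W v w = hTensor v w := rfl

theorem hTensor_C (v : V) (w : W) :
    hTensor (PowerSeries.C v) (PowerSeries.C w) = PowerSeries.C (v ⊗ₜ[ℂ] w) := by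
  rw [hTensor_eq_mul, PowerSeries.map_C, PowerSeries.map_C, ← map_mul]
  simp

theorem hTensor_one_one : hTensor (1 : V⟦X⟧) (1 : W⟦X⟧) = PowerSeries.C 1 := by
  rw [hTensor_eq_mul, map_one, map_one, mul_one, map_one]

theorem hTensor_C_left (v : V) (w : W⟦X⟧) :
    hTensor (PowerSeries.C v) w = (HMap.const (TensorProduct.mk ℂ V W v)).toLinear w := by
  refine LinearMap.congr_fun (f := hTensorBilin V W (PowerSeries.C v))
    (hAdic_linearMap_ext fun w => ?_) w
  rw [hTensorBilin_apply, hTensor_C, HMap.const_toLinear_C, TensorProduct.mk_apply]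

end HAdic

section SeriesRep

variable {K K' V W : Type*} [Ring K] [Algebra ℂ K] [Ring K'] [Algebra ℂ K'] [Ring V] [Algebra ℂ V]
  [Ring W] [Algebra ℂ W]

/-- The action of a series `∑ hᵏ aₖ` on `V[[h]]`, as the series of the actions of the `aₖ`. -/
def HMap.ofRep (ρ : K →ₐ[ℂ] Module.End ℂ V) (a : K⟦X⟧) : HMap V V :=
  fun k => ρ (PowerSeries.coeff k a)

theorem HMap.coeff_ofRep_toLinear_C (ρ : K →ₐ[ℂ] Module.End ℂ V) (a : K⟦X⟧) (v : V) (k : ℕ) :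
    PowerSeries.coeff k ((ofRep ρ a).toLinear (PowerSeries.C v)) = ρ (PowerSeries.coeff k a) v :=
  coeff_toLinear_C _ v k

/-- The `ℂ[[h]]`-linear extension of a representation: `K[[h]]` acts on `V[[h]]` by
`(∑ hⁱ aᵢ) ▷ (∑ hʲ vⱼ) = ∑ hⁱ⁺ʲ ρ(aᵢ) vⱼ`. -/
def seriesRep (ρ : K →ₐ[ℂ] Module.End ℂ V) : K⟦X⟧ →ₐ[ℂ⟦X⟧] Module.End ℂ⟦X⟧ V⟦X⟧ :=
  AlgHom.ofLinearMap
    { toFun := fun a => (HMap.ofRep ρ a).toLinear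
      map_add' := fun a b => hAdic_linearMap_ext fun v => by
        ext k
        simp only [LinearMap.add_apply, map_add, HMap.coeff_ofRep_toLinear_C]
      map_smul' := fun c a => hAdic_linearMap_ext fun v => by
        ext k
        simp only [RingHom.id_apply, LinearMap.smul_apply, coeff_hAdic_smul, map_sum, map_smul,
          LinearMap.sum_apply, HMap.coeff_ofRep_toLinear_C] }
    (hAdic_linearMap_ext fun v => by
      ext k
      simp only [LinearMap.coe_mk, AddHom.coe_mk, HMap.coeff_ofRep_toLinear_C,
        PowerSeries.coeff_one, Module.End.one_apply, PowerSeries.coeff_C]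
      split_ifs <;> simp)
    (fun a b => hAdic_linearMap_ext fun v => by
      ext k
      simp only [LinearMap.coe_mk, AddHom.coe_mk, Module.End.mul_apply, HMap.coeff_ofRep_toLinear_C,
        PowerSeries.coeff_mul, map_sum, map_mul, LinearMap.sum_apply]
      rw [HMap.coeff_toLinear]
      simp only [HMap.coeff_ofRep_toLinear_C, HMap.ofRep])

theorem coeff_seriesRep_C (ρ : K →ₐ[ℂ] Module.End ℂ V) (a : K⟦X⟧) (v : V) (k : ℕ) :
    PowerSeries.coeff k (seriesRep ρ a (PowerSeries.C v)) = ρ (PowerSeries.coeff k a) v :=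
  HMap.coeff_ofRep_toLinear_C ρ a v k

theorem coeff_zero_seriesRep (ρ : K →ₐ[ℂ] Module.End ℂ V) (a : K⟦X⟧) (v : V⟦X⟧) :
    PowerSeries.coeff 0 (seriesRep ρ a v) = ρ (PowerSeries.coeff 0 a) (PowerSeries.coeff 0 v) :=
  (HMap.coeff_toLinear _ v 0).trans (Finset.sum_singleton _ _)

theorem seriesRep_map (ρ : K' →ₐ[ℂ] Module.End ℂ V) (φ : K →ₐ[ℂ] K') (a : K⟦X⟧) :
    seriesRep ρ (PowerSeries.map φ.toRingHom a) = seriesRep (ρ.comp φ) a :=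
  rfl

theorem const_toLinear_seriesRep {ρ : K →ₐ[ℂ] Module.End ℂ V} {σ : K →ₐ[ℂ] Module.End ℂ W}
    {t : V →ₗ[ℂ] W} (h : ∀ a v, t (ρ a v) = σ a (t v)) (a : K⟦X⟧) (v : V⟦X⟧) :
    (HMap.const t).toLinear (seriesRep ρ a v) = seriesRep σ a ((HMap.const t).toLinear v) := by
  refine LinearMap.congr_fun (f := (HMap.const t).toLinear ∘ₗ seriesRep ρ a)
    (g := seriesRep σ a ∘ₗ (HMap.const t).toLinear) (hAdic_linearMap_ext fun v => ?_) v
  ext k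
  rw [LinearMap.comp_apply, LinearMap.comp_apply, HMap.const_toLinear_C, HMap.coeff_const_toLinear,
    coeff_seriesRep_C, coeff_seriesRep_C, h]

end SeriesRep

/-! ### `h`-adic smash products -/

section Smash

variable {A H : Type*} [Ring A] [Algebra ℂ A]

namespace SmashProduct

variable [Ring H] [Algebra ℂ H] (act : H →ₐ[ℂ] Module.End ℂ A) (m : HMap (A ⊗[ℂ] A) A)
  (δ : HMap H (H ⊗[ℂ] H))

/-- The product of a smash product as a `ℂ[[h]]`-bilinear map on `(A ⊗ H)[[h]]`. -/
def mulBilin : (A ⊗[ℂ] H)⟦X⟧ →ₗ[ℂ⟦X⟧] (A ⊗[ℂ] H)⟦X⟧ →ₗ[ℂ⟦X⟧] (A ⊗[ℂ] H)⟦X⟧ :=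
  (hTensorBilin (A ⊗[ℂ] H) (A ⊗[ℂ] H)).compr₂ (smashMap act m δ).toLinear

theorem coeff_mulBilin_C (a b : A ⊗[ℂ] H) (k : ℕ) :
    PowerSeries.coeff k (mulBilin act m δ (PowerSeries.C a) (PowerSeries.C b)) =
      smashMap act m δ k (a ⊗ₜ b) := by
  rw [← HMap.coeff_toLinear_C (smashMap act m δ), ← hTensor_C]
  rfl

variable {act m δ} in
theorem isUnitalAssocAlgebra
    (mul_assoc : ∀ a b c : SmashProduct act m δ, a * b * c = a * (b * c))
    (one_mul : ∀ a : SmashProduct act m δ, 1 * a = a)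
    (mul_one : ∀ a : SmashProduct act m δ, a * 1 = a) :
    IsUnitalAssocAlgebra (SmashProduct act m δ) where
  add_mul := LinearMap.map_add₂ (mulBilin act m δ)
  mul_add a := map_add (mulBilin act m δ a)
  smul_mul := LinearMap.map_smul₂ (mulBilin act m δ)
  mul_smul t a := map_smul (mulBilin act m δ a) t
  mul_assoc := mul_assoc
  one_mul := one_mul
  mul_one := mul_one

end SmashProduct

variable [Ring H] [Bialgebra ℂ H] (act : H →ₐ[ℂ] Module.End ℂ A)

theorem smashCore_mul'_comp_tensorRep_tmul (X : H ⊗[ℂ] H) (δ : H →ₗ[ℂ] H ⊗[ℂ] H) (f : A) (L : H)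
    (b : A ⊗[ℂ] H) :
    smashCore act (LinearMap.mul' ℂ A ∘ₗ tensorRep act act X) δ ((f ⊗ₜ L) ⊗ₜ b) =
      mulFst ℂ A H (tripleAct act (leg₁₂ ℂ H X) (f ⊗ₜ pairAct act (δ L) b)) := by
  induction b with
  | zero => simp
  | add b b' hb hb' => simp only [TensorProduct.tmul_add, map_add, hb, hb']
  | tmul g M =>
    simp only [smashCore, LinearMap.comp_apply, LinearMap.rTensor_tmul, LinearMap.lTensor_tmul,
      LinearEquiv.coe_coe, TensorProduct.assoc_tmul]
    induction δ L with
    | zero => simp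
    | add Y Y' hY hY' =>
      simp only [TensorProduct.add_tmul, TensorProduct.tmul_add, map_add, LinearMap.add_apply,
        hY, hY']
    | tmul P Q =>
      have h := mulFst_tripleAct_assoc act X 1 f (act P g) (Q * M)
      rw [one_mul] at h
      exact h.symm

theorem smashCore_mul'_comul (a b : A ⊗[ℂ] H) :
    smashCore act (LinearMap.mul' ℂ A) CoalgebraStruct.comul (a ⊗ₜ b) = smashMul act a b := by
  induction a with
  | zero => simp
  | add a a' ha ha' => simp only [TensorProduct.add_tmul, map_add, LinearMap.add_apply, ha, ha']
  | tmul f L =>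
    have h := smashCore_mul'_comp_tensorRep_tmul act 1 CoalgebraStruct.comul f L b
    rwa [map_one, Module.End.one_eq_id, LinearMap.comp_id, map_one, map_one, Module.End.one_apply,
      mulFst_tmul, ← smashMul_tmul] at h

/-- The undeformed product of the smash product `A[[h]] ⋊ H[[h]]`. -/
abbrev hSmashMul : (A ⊗[ℂ] H)⟦X⟧ →ₗ[ℂ⟦X⟧] (A ⊗[ℂ] H)⟦X⟧ →ₗ[ℂ⟦X⟧] (A ⊗[ℂ] H)⟦X⟧ :=
  SmashProduct.mulBilin act (HMap.const (LinearMap.mul' ℂ A)) (HMap.const CoalgebraStruct.comul)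

theorem hSmashMul_C (a b : A ⊗[ℂ] H) :
    hSmashMul act (PowerSeries.C a) (PowerSeries.C b) = PowerSeries.C (smashMul act a b) := by
  ext k
  rw [SmashProduct.coeff_mulBilin_C, PowerSeries.coeff_C, smashMap]
  split_ifs with hk
  · subst hk
    simpa [HMap.const] using smashCore_mul'_comul act a b
  · rw [LinearMap.sum_apply]
    refine Finset.sum_eq_zero fun p hp => ?_
    rcases eq_or_ne p.1 0 with h₁ | h₁
    · have h₂ : p.2 ≠ 0 := by
        have := Finset.HasAntidiagonal.mem_antidiagonal.1 hp
        omega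
      simp [HMap.const, h₂, smashCore]
    · simp [HMap.const, h₁, smashCore]

theorem hSmashMul_C_right (a : (A ⊗[ℂ] H)⟦X⟧) (b : A ⊗[ℂ] H) :
    hSmashMul act a (PowerSeries.C b) = (HMap.const ((smashMul act).flip b)).toLinear a := by
  refine LinearMap.congr_fun (f := (hSmashMul act).flip (PowerSeries.C b))
    (hAdic_linearMap_ext fun a => ?_) a
  rw [LinearMap.flip_apply, hSmashMul_C, HMap.const_toLinear_C, LinearMap.flip_apply]

theorem hSmashMul_seriesRep_C_tmul (X : (H ⊗[ℂ] H)⟦X⟧) (f : A) (L : H) (b : (A ⊗[ℂ] H)⟦X⟧) :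
    hSmashMul act (seriesRep (pairAct act) X (PowerSeries.C (f ⊗ₜ L))) b =
      (HMap.const (mulFst ℂ A H)).toLinear (seriesRep (tripleAct act)
        (PowerSeries.map (comulRight ℂ H).toRingHom X *
          PowerSeries.map (leg₂₃ ℂ H).toRingHom (PowerSeries.C (CoalgebraStruct.comul L)))
        (hTensor (PowerSeries.C f) b)) := by
  refine LinearMap.congr_fun (g := (HMap.const (mulFst ℂ A H)).toLinear ∘ₗ
    seriesRep (tripleAct act) _ ∘ₗ hTensorBilin A (A ⊗[ℂ] H) (PowerSeries.C f))
    (hAdic_linearMap_ext fun b => ?_) b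
  ext k
  rw [hSmashMul_C_right, HMap.coeff_const_toLinear, coeff_seriesRep_C, LinearMap.flip_apply,
    smashMul_pairAct_tmul, LinearMap.comp_apply, LinearMap.comp_apply, hTensorBilin_apply,
    hTensor_C, HMap.coeff_const_toLinear, coeff_seriesRep_C, PowerSeries.map_C,
    PowerSeries.coeff_mul_C, PowerSeries.coeff_map]
  rfl

theorem seriesRep_tripleAct_leg₂₃_hTensor (Y : (H ⊗[ℂ] H)⟦X⟧) (f : A) (b : (A ⊗[ℂ] H)⟦X⟧) :
    seriesRep (tripleAct act) (PowerSeries.map (leg₂₃ ℂ H).toRingHom Y)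
        (hTensor (PowerSeries.C f) b) =
      hTensor (PowerSeries.C f) (seriesRep (pairAct act) Y b) := by
  rw [hTensor_C_left, hTensor_C_left, seriesRep_map]
  exact (const_toLinear_seriesRep (fun Y b => (tripleAct_leg₂₃_tmul act Y f b).symm) Y b).symm

namespace IsModuleAlgebra

variable {act}

theorem seriesRep_pairAct_mulFst (hact : IsModuleAlgebra act) (X : (H ⊗[ℂ] H)⟦X⟧)
    (t : (A ⊗[ℂ] (A ⊗[ℂ] H))⟦X⟧) :
    seriesRep (pairAct act) X ((HMap.const (mulFst ℂ A H)).toLinear t) =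
      (HMap.const (mulFst ℂ A H)).toLinear (seriesRep (tripleAct act)
        (PowerSeries.map (comulLeft ℂ H).toRingHom X) t) := by
  rw [seriesRep_map]
  exact (const_toLinear_seriesRep (fun Y t => (hact.pairAct_mulFst Y t).symm) X t).symm

theorem isUnitalAssocAlgebra_smashProduct (hact : IsModuleAlgebra act) :
    IsUnitalAssocAlgebra (SmashProduct act (HMap.const (LinearMap.mul' ℂ A))
      (HMap.const (CoalgebraStruct.comul (R := ℂ) (A := H)))) := by
  refine SmashProduct.isUnitalAssocAlgebra ?_ ?_ ?_
  · refine hAdic_bilin_assoc (B := hSmashMul act) fun u v w => ?_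
    rw [hSmashMul_C, hSmashMul_C, hSmashMul_C, hSmashMul_C, hact.smashMul_assoc]
  · refine LinearMap.congr_fun (f := hSmashMul act (hTensor 1 1)) (g := LinearMap.id)
      (hAdic_linearMap_ext fun a => ?_)
    rw [hTensor_one_one, hSmashMul_C, one_smashMul, LinearMap.id_apply]
  · refine LinearMap.congr_fun (f := (hSmashMul act).flip (hTensor 1 1)) (g := LinearMap.id)
      (hAdic_linearMap_ext fun a => ?_)
    rw [LinearMap.flip_apply, hTensor_one_one, hSmashMul_C, hact.smashMul_one, LinearMap.id_apply]

end IsModuleAlgebra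

end Smash

/-! ### Untwisting -/

namespace DrinfeldTwist

variable {H : Type*} [Ring H] [Bialgebra ℂ H] (T : DrinfeldTwist H)

theorem F_mul_inv : (T.F : (H ⊗[ℂ] H)⟦X⟧) * T.inv = 1 := T.F.mul_inv

theorem inv_mul_F : T.inv * (T.F : (H ⊗[ℂ] H)⟦X⟧) = 1 := T.F.inv_mul

theorem coeff_zero_inv : PowerSeries.coeff 0 T.inv = 1 := by
  have h := congrArg (PowerSeries.coeff 0) T.F_mul_inv
  simpa [PowerSeries.coeff_mul, T.coeff_zero] using h

theorem counitLeft_inv : PowerSeries.map (counitLeft ℂ H).toRingHom T.inv = 1 := by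
  have h := congrArg (PowerSeries.map (counitLeft ℂ H).toRingHom) T.F_mul_inv
  rwa [map_mul, counitLeft, T.counit_left, one_mul, map_one] at h

theorem cocycle_inv :
    PowerSeries.map (comulLeft ℂ H).toRingHom T.inv * PowerSeries.map (leg₁₂ ℂ H).toRingHom T.inv =
      PowerSeries.map (comulRight ℂ H).toRingHom T.inv *
        PowerSeries.map (leg₂₃ ℂ H).toRingHom T.inv := by
  let image (φ : H ⊗[ℂ] H →ₐ[ℂ] H ⊗[ℂ] (H ⊗[ℂ] H)) : ((H ⊗[ℂ] (H ⊗[ℂ] H))⟦X⟧)ˣ :=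
    Units.map (PowerSeries.map φ.toRingHom : _ →* _) T.F
  have cocycle : image (leg₁₂ ℂ H) * image (comulLeft ℂ H) =
      image (leg₂₃ ℂ H) * image (comulRight ℂ H) := by
    refine Units.ext (Eq.trans ?_ T.cocycle)
    rw [map_mul]
    rfl
  have inverse := congrArg (·⁻¹) cocycle
  simp only [mul_inv_rev] at inverse
  exact congrArg Units.val inverse

variable {A : Type*} [Ring A] [Algebra ℂ A] (act : H →ₐ[ℂ] Module.End ℂ A)

theorem star_apply (k : ℕ) :
    T.star act k = LinearMap.mul' ℂ A ∘ₗ tensorRep act act (PowerSeries.coeff k T.inv) :=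
  rfl

theorem hat_apply (k : ℕ) (f : A) :
    T.hat act k f = pairAct act (PowerSeries.coeff k T.inv) (f ⊗ₜ 1) := by
  have lmul_flip_one : (Algebra.lmul ℂ H).toLinearMap.flip 1 = LinearMap.id :=
    LinearMap.ext mul_one
  rw [tensorRep_apply_tmul, lmul_flip_one]
  rfl

/-- The product of the twisted smash product `A[[h]]^F ⋊ (H[[h]])^F`. -/
abbrev twistSmashMul : (A ⊗[ℂ] H)⟦X⟧ →ₗ[ℂ⟦X⟧] (A ⊗[ℂ] H)⟦X⟧ →ₗ[ℂ⟦X⟧] (A ⊗[ℂ] H)⟦X⟧ :=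
  SmashProduct.mulBilin act (T.star act) T.comul

theorem twistSmashMul_C_tmul_C (f : A) (L : H) (b : A ⊗[ℂ] H) :
    T.twistSmashMul act (PowerSeries.C (f ⊗ₜ L)) (PowerSeries.C b) =
      (HMap.const (mulFst ℂ A H)).toLinear (seriesRep (tripleAct act)
        (PowerSeries.map (leg₁₂ ℂ H).toRingHom T.inv * PowerSeries.map (leg₂₃ ℂ H).toRingHom
          ((T.F : (H ⊗[ℂ] H)⟦X⟧) * PowerSeries.C (CoalgebraStruct.comul L) * T.inv))
        (PowerSeries.C (f ⊗ₜ b))) := by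
  ext k
  rw [SmashProduct.coeff_mulBilin_C, smashMap, LinearMap.sum_apply, HMap.coeff_const_toLinear,
    coeff_seriesRep_C, PowerSeries.coeff_mul, map_sum, LinearMap.sum_apply, map_sum]
  refine Finset.sum_congr rfl fun p _ => ?_
  rw [star_apply, smashCore_mul'_comp_tensorRep_tmul, ← tripleAct_leg₂₃_tmul, map_mul]
  rfl

/-- The `ℂ[[h]]`-linear automorphism `f ⊗ L ↦ F⁻¹ ▷ (f ⊗ L) = (f̄^α ▷ f) ⊗ f̄_α L` of
`(A ⊗ H)[[h]]`. -/
def untwist : (A ⊗[ℂ] H)⟦X⟧ ≃ₗ[ℂ⟦X⟧] (A ⊗[ℂ] H)⟦X⟧ :=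
  LinearEquiv.ofLinearMap (seriesRep (pairAct act) T.inv) (seriesRep (pairAct act) T.F)
    (by rw [← Module.End.mul_eq_comp, ← map_mul, inv_mul_F, map_one, Module.End.one_eq_id])
    (by rw [← Module.End.mul_eq_comp, ← map_mul, F_mul_inv, map_one, Module.End.one_eq_id])

theorem untwist_apply (a : (A ⊗[ℂ] H)⟦X⟧) :
    T.untwist act a = seriesRep (pairAct act) T.inv a := rfl

variable {act}

theorem untwist_twistSmashMul_C_tmul_C (hact : IsModuleAlgebra act) (f : A) (L : H) (b : A ⊗[ℂ] H) :
    T.untwist act (T.twistSmashMul act (PowerSeries.C (f ⊗ₜ L)) (PowerSeries.C b)) =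
      hSmashMul act (T.untwist act (PowerSeries.C (f ⊗ₜ L)))
        (T.untwist act (PowerSeries.C b)) := by
  set ΔL : (H ⊗[ℂ] H)⟦X⟧ := PowerSeries.C (CoalgebraStruct.comul L)
  let φ₁₂ := PowerSeries.map (leg₁₂ ℂ H).toRingHom
  let φ₂₃ := PowerSeries.map (leg₂₃ ℂ H).toRingHom
  let Δl := PowerSeries.map (comulLeft ℂ H).toRingHom
  let Δr := PowerSeries.map (comulRight ℂ H).toRingHom
  have cocycle : Δl T.inv * (φ₁₂ T.inv * φ₂₃ (T.F * ΔL * T.inv)) =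
      Δr T.inv * φ₂₃ ΔL * φ₂₃ T.inv := calc
    _ = Δr T.inv * φ₂₃ (T.inv * (T.F * ΔL * T.inv)) := by
      rw [← mul_assoc, T.cocycle_inv, mul_assoc, map_mul φ₂₃ T.inv]
    _ = Δr T.inv * φ₂₃ ΔL * φ₂₃ T.inv := by
      rw [mul_assoc (T.F : (H ⊗[ℂ] H)⟦X⟧), ← mul_assoc T.inv, inv_mul_F, one_mul, map_mul,
        mul_assoc]
  simp only [untwist_apply]
  rw [twistSmashMul_C_tmul_C, hact.seriesRep_pairAct_mulFst, hSmashMul_seriesRep_C_tmul,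
    ← seriesRep_tripleAct_leg₂₃_hTensor, hTensor_C, ← Module.End.mul_apply, ← map_mul,
    ← Module.End.mul_apply, ← map_mul]
  exact congrArg (fun Y => (HMap.const (mulFst ℂ A H)).toLinear
    (seriesRep (tripleAct act) Y (PowerSeries.C (f ⊗ₜ b)))) cocycle

theorem untwist_twistSmashMul (hact : IsModuleAlgebra act) (a b : (A ⊗[ℂ] H)⟦X⟧) :
    T.untwist act (T.twistSmashMul act a b) =
      hSmashMul act (T.untwist act a) (T.untwist act b) := by
  suffices h : (T.twistSmashMul act).compr₂ (T.untwist act).toLinearMap =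
      (hSmashMul act).compl₁₂ (T.untwist act).toLinearMap (T.untwist act).toLinearMap from
    LinearMap.congr_fun₂ h a b
  refine hAdic_bilin_ext fun a b => ?_
  simp only [LinearMap.compr₂_apply, LinearMap.compl₁₂_apply, LinearEquiv.coe_coe]
  induction a with
  | zero => simp only [map_zero, LinearMap.zero_apply]
  | add a a' ha ha' => simp only [map_add, LinearMap.add_apply, ha, ha']
  | tmul f L => exact T.untwist_twistSmashMul_C_tmul_C hact f L b

theorem untwist_hTensor_one (f : A⟦X⟧) :
    T.untwist act (hTensor f 1) = (T.hat act).toLinear f := by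
  refine LinearMap.congr_fun
    (f := (T.untwist act).toLinearMap ∘ₗ (hTensorBilin A H).flip (PowerSeries.C 1))
    (g := (T.hat act).toLinear) (hAdic_linearMap_ext fun x => ?_) f
  ext k
  rw [HMap.coeff_toLinear_C, hat_apply, ← coeff_seriesRep_C, ← hTensor_C]
  rfl

theorem untwist_one_hTensor (hact : IsModuleAlgebra act) (L : H⟦X⟧) :
    T.untwist act (hTensor 1 L) = hTensor 1 L := by
  refine LinearMap.congr_fun
    (f := (T.untwist act).toLinearMap ∘ₗ hTensorBilin A H (PowerSeries.C 1))
    (g := hTensorBilin A H (PowerSeries.C 1)) (hAdic_linearMap_ext fun x => ?_) L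
  have counit (k : ℕ) : counitLeft ℂ H (PowerSeries.coeff k T.inv) = if k = 0 then 1 else 0 := by
    rw [← PowerSeries.coeff_one, ← T.counitLeft_inv]
    rfl
  ext k
  rw [LinearMap.comp_apply, LinearEquiv.coe_coe, hTensorBilin_apply, hTensor_C, untwist_apply,
    coeff_seriesRep_C, hact.pairAct_one_tmul, counit, PowerSeries.coeff_C]
  split_ifs <;> simp

theorem exists_untwist_eq_add_X_smul (a : (A ⊗[ℂ] H)⟦X⟧) :
    ∃ c : (A ⊗[ℂ] H)⟦X⟧, T.untwist act a = a + (PowerSeries.X : ℂ⟦X⟧) • c :=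
  exists_eq_add_X_smul (by
    rw [untwist_apply, coeff_zero_seriesRep, coeff_zero_inv, map_one, Module.End.one_apply])

variable (act) in
/-- The automorphism `untwist` as a map `A[[h]]^F ⋊ (H[[h]])^F → A[[h]] ⋊ H[[h]]`. -/
def smashEquiv :
    SmashProduct act (T.star act) T.comul ≃ₗ[ℂ⟦X⟧]
      SmashProduct act (HMap.const (LinearMap.mul' ℂ A))
        (HMap.const (CoalgebraStruct.comul (R := ℂ) (A := H))) :=
  (SmashProduct.ofSeries _ _ _).symm.trans ((T.untwist act).trans (SmashProduct.ofSeries _ _ _))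

theorem smashEquiv_mul (hact : IsModuleAlgebra act)
    (a b : SmashProduct act (T.star act) T.comul) :
    T.smashEquiv act (a * b) = T.smashEquiv act a * T.smashEquiv act b :=
  T.untwist_twistSmashMul hact a b

theorem smashEquiv_one (hact : IsModuleAlgebra act) : T.smashEquiv act 1 = 1 :=
  T.untwist_one_hTensor hact 1

theorem isUnitalAssocAlgebra_smashProduct (hact : IsModuleAlgebra act) :
    IsUnitalAssocAlgebra (SmashProduct act (T.star act) T.comul) := by
  have h := hact.isUnitalAssocAlgebra_smashProduct
  refine SmashProduct.isUnitalAssocAlgebra (fun a b c => ?_) (fun a => ?_) (fun a => ?_) <;>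
    apply (T.smashEquiv act).injective
  · simp only [T.smashEquiv_mul hact, h.mul_assoc]
  · rw [T.smashEquiv_mul hact, T.smashEquiv_one hact, h.one_mul]
  · rw [T.smashEquiv_mul hact, T.smashEquiv_one hact, h.mul_one]

end DrinfeldTwist

end TwistSmash

end

theorem proposition2_general {A H : Type*} [Ring A] [Algebra ℂ A] [Ring H] [Bialgebra ℂ H]
    {act : H →ₐ[ℂ] Module.End ℂ A} (hact : IsModuleAlgebra act) (T : DrinfeldTwist H) :
    IsUnitalAssocAlgebra (SmashProduct act (HMap.const (LinearMap.mul' ℂ A))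
      (HMap.const (CoalgebraStruct.comul (R := ℂ) (A := H)))) ∧
    IsUnitalAssocAlgebra (SmashProduct act (T.star act) T.comul) ∧
    ∃ φ : SmashProduct act (T.star act) T.comul ≃ₗ[ℂ⟦X⟧]
        SmashProduct act (HMap.const (LinearMap.mul' ℂ A))
          (HMap.const (CoalgebraStruct.comul (R := ℂ) (A := H))),
      φ 1 = 1 ∧
      (∀ a b : SmashProduct act (T.star act) T.comul, φ (a * b) = φ a * φ b) ∧
      (∀ f : A⟦X⟧, (φ (SmashProduct.inl f)).series = (T.hat act).toLinear f) ∧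
      (∀ L : H⟦X⟧, φ (SmashProduct.inr L) = SmashProduct.inr L) ∧
      (∀ a : SmashProduct act (T.star act) T.comul, ∃ c : (A ⊗[ℂ] H)⟦X⟧,
        (φ a).series = a.series + (PowerSeries.X : ℂ⟦X⟧) • c) :=
  ⟨hact.isUnitalAssocAlgebra_smashProduct, T.isUnitalAssocAlgebra_smashProduct hact,
    T.smashEquiv act, T.smashEquiv_one hact, T.smashEquiv_mul hact,
    T.untwist_hTensor_one, T.untwist_one_hTensor hact, T.exists_untwist_eq_add_X_smul⟩

theorem proposition2 (n : ℕ) (T : DrinfeldTwist (UIGL n)) :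
    IsUnitalAssocAlgebra (IGLSmash n) ∧
    IsUnitalAssocAlgebra (TwistedIGLSmash T) ∧
    ∃ φ : TwistedIGLSmash T ≃ₗ[ℂ⟦X⟧] IGLSmash n,
      φ 1 = 1 ∧
      (∀ a b : TwistedIGLSmash T, φ (a * b) = φ a * φ b) ∧
      (∀ f : (Coord n)⟦X⟧, (φ (SmashProduct.inl f)).series =
        (T.hat (iglAction n)).toLinear f) ∧
      (∀ L : (UIGL n)⟦X⟧, φ (SmashProduct.inr L) = SmashProduct.inr L) ∧
      (∀ a : TwistedIGLSmash T, ∃ c : (Coord n ⊗[ℂ] UIGL n)⟦X⟧,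
        (φ a).series = a.series + (PowerSeries.X : ℂ⟦X⟧) • c) :=
  proposition2_general (iglAction_isModuleAlgebra n) T
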